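/- Let $g\ge 2$ and let $X=V/\Lambda$ be a complex torus of dimension $g$ with period matrix $(\tau\;\, I_g)$, that is, $V$ is a complex vector space of dimension $g$, $\Lambda\subset V$ is a lattice, and for a suitable complex basis of $V$ and a suitable $\mathbb Z$-basis of $\Lambda$ the columns of $(\tau\;\, I_g)$ are the coordinate vectors of the basis of $\Lambda$; here $\tau=(\tau_{ij})\in M_g(\mathbb C)$ satisfies $\det(\operatorname{Im}\tau)\ne 0$. Let $\rho$ be the Picard number of $X$, i.e. the rank of its Néron–Severi group $\mathrm{NS}(X)=c_1(\mathrm{Pic}(X))\subset H^2(X,\mathbb Z)$, and let $\mathfrak d=[\mathbb Q(\{\tau_{ij}\}):\mathbb Q]$. Then: 1. $\mathfrak d=2$ if and only if $\rho=g^2$ (that is, $X$ is $\rho$-maximal); and in this case $X$ is an abelian variety, i.e. it admits a line bundle whose first Chern class is a positive definite Hermitian form. 2. If $\mathfrak d=3$, then $\frac{g(g+1)}{2}\le\rho<g^2$. 3. If $\mathfrak d=4$, then $g\le\rho<g^2$. -/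

import Mathlib

/-!
Complex tori `X = V / Λ`, where `V` is a finite dimensional complex vector space and `Λ ⊆ V` is a
lattice (a discrete subgroup of full rank).
-/

namespace ComplexTorus

variable {V : Type*} [NormedAddCommGroup V] [NormedSpace ℂ V]

/-- The group of holomorphic line bundles on `X = V / Λ`, presented by factors of automorphy, that
is, by `1`-cocycles of `Λ` with values in the nowhere vanishing holomorphic functions on `V`.
The cocycle `a` stands for the quotient of `V × ℂ` by the action `l • (v, t) = (v + l, a l v * t)`
of `Λ`. The group law is the tensor product. -/
def lineBundles (Λ : Submodule ℤ V) : Subgroup (Λ → V → ℂˣ) where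
  carrier := {a | (∀ l, Differentiable ℂ fun v => (a l v : ℂ)) ∧
    ∀ (l m : Λ) (v : V), a (l + m) v = a l (v + m) * a m v}
  one_mem' := ⟨fun _ => by simp, fun _ _ _ => by simp⟩
  mul_mem' := by
    rintro a b ⟨ha, ha'⟩ ⟨hb, hb'⟩
    refine ⟨fun l => ?_, fun l m v => ?_⟩
    · simpa using (ha l).fun_mul (hb l)
    · simp only [Pi.mul_apply, ha', hb']
      exact mul_mul_mul_comm _ _ _ _
  inv_mem' := by
    rintro a ⟨ha, ha'⟩
    refine ⟨fun l => ?_, fun l m v => ?_⟩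
    · simpa using (ha l).fun_inv (fun v => (a l v).ne_zero)
    · simp only [Pi.inv_apply, ha', mul_inv]

/-- `E` is the first Chern class of the line bundle with factor of automorphy `a`, as an element of
`H²(X, ℤ)`, the group of alternating forms `Λ × Λ → ℤ`: writing `a l v = exp (2πi f l v)` with
`f l` holomorphic,
`E (l, m) = f m (v + l) + f l v - f l (v + m) - f m v` for all `v`. -/
def IsChernClass (Λ : Submodule ℤ V) (a : Λ → V → ℂˣ) (E : LinearMap.BilinForm ℤ Λ) : Prop :=
  ∃ f : Λ → V → ℂ, (∀ l, Differentiable ℂ (f l)) ∧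
    (∀ l v, (a l v : ℂ) = Complex.exp (2 * Real.pi * Complex.I * f l v)) ∧
    ∀ (l m : Λ) (v : V), (E l m : ℂ) = f m (v + l) + f l v - f l (v + m) - f m v

/-- The Néron-Severi group `NS(X)` of `X = V / Λ`: the image of the first Chern class
`Pic(X) → H²(X, ℤ)`. -/
def neronSeveri (Λ : Submodule ℤ V) : AddSubgroup (LinearMap.BilinForm ℤ Λ) where
  carrier := {E | ∃ a ∈ lineBundles Λ, IsChernClass Λ a E}
  zero_mem' := ⟨1, one_mem _, fun _ _ => 0, fun _ => by simp, fun _ _ => by simp,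
    fun _ _ _ => by simp⟩
  add_mem' := by
    rintro E E' ⟨a, ha, f, hf, hf', hE⟩ ⟨b, hb, k, hk, hk', hE'⟩
    refine ⟨a * b, mul_mem ha hb, fun l v => f l v + k l v, fun l => (hf l).fun_add (hk l),
      fun l v => ?_, fun l m v => ?_⟩
    · simp only [Pi.mul_apply, Units.val_mul, hf', hk', ← Complex.exp_add]
      ring_nf
    · simp only [LinearMap.add_apply, Int.cast_add, hE l m v, hE' l m v]
      ring
  neg_mem' := by
    rintro E ⟨a, ha, f, hf, hf', hE⟩
    refine ⟨a⁻¹, inv_mem ha, fun l v => -f l v, fun l => (hf l).fun_neg,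
      fun l v => ?_, fun l m v => ?_⟩
    · simp only [Pi.inv_apply, Units.val_inv_eq_inv_val, hf', ← Complex.exp_neg]
      ring_nf
    · simp only [LinearMap.neg_apply, Int.cast_neg, hE l m v]
      ring

/-- The Picard number `ρ(X)` of `X = V / Λ`, the rank of its Néron-Severi group. -/
noncomputable def picardNumber (Λ : Submodule ℤ V) : ℕ :=
  Module.finrank ℤ (neronSeveri Λ)

/-- `E` is positive: it is the restriction to `Λ` of the imaginary part of a positive definite
Hermitian form `H` on `V` (linear in the first variable). -/
def IsPositive (Λ : Submodule ℤ V) (E : LinearMap.BilinForm ℤ Λ) : Prop :=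
  ∃ H : V →ₗ[ℂ] V →ₗ⋆[ℂ] ℂ,
    (∀ v w, H w v = starRingEnd ℂ (H v w)) ∧ (∀ v, v ≠ 0 → 0 < (H v v).re) ∧
    ∀ l m : Λ, (H l m).im = E l m

/-- The complex torus `X = V / Λ` is an abelian variety: it admits a polarization, i.e. the first
Chern class of a positive definite line bundle. -/
def IsAbelianVariety (Λ : Submodule ℤ V) : Prop :=
  ∃ E ∈ neronSeveri Λ, IsPositive Λ E

/-- `P` is a period matrix of the complex torus `X = V / Λ` of dimension `g`: for some complex
basis of `V`, the columns of `P` are the coordinate vectors of the members of a `ℤ`-basis of `Λ`.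
The columns are indexed by `Fin g ⊕ Fin g`. -/
def IsPeriodMatrix {g : ℕ} (Λ : Submodule ℤ V) (P : Matrix (Fin g) (Fin g ⊕ Fin g) ℂ) : Prop :=
  ∃ (b : Module.Basis (Fin g) ℂ V) (l : Module.Basis (Fin g ⊕ Fin g) ℤ Λ),
    ∀ j, (l j : V) = ∑ i, P i j • b i

/-- The degree `[ℚ({τ i j}) : ℚ]` of the extension generated by the entries of `τ`
(with value `0` if it is infinite). -/
noncomputable def periodDegree {g : ℕ} (τ : Matrix (Fin g) (Fin g) ℂ) : ℕ :=
  Module.finrank ℚ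
    (IntermediateField.adjoin ℚ {z : ℂ | ∃ i j, z = τ i j})

end ComplexTorus

/-! The Néron–Severi group consists of the integral alternating forms on `Λ` whose real extension is
of type (1,1). A factor of automorphy yields type (1,1) by averaging differentials over facets of a
fundamental cell (`realGram_mem_hodgeMatrices`). Conversely, an explicit affine cocycle realizes a
form (`mem_neronSeveri_of_dual`).

Lower bounds: for the period matrix `(τ I)` and an alternating form with blocks `A`, `B`, `C`, type
(1,1) is the relation `A - Bτ + τᵗBᵗ + τᵗCτ = 0`. It is antisymmetric with entries in a field of
degree `𝔡`, so it imposes at most `𝔡 g(g-1)/2` rational conditions on a lattice of rank `g(2g-1)`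
(`le_picardNumber`). The difference is `g²`, `g(g+1)/2`, `g` for `𝔡 = 2, 3, 4`.

Upper bound: the real (1,1)-forms have dimension at most `g²`. If `ρ = g²`, integral forms span
them. The equations saying that multiplication by `i` is skew for these forms then have integer
coefficients, so a ℚ-linear functional applied to its matrix gives a nonzero rational solution. For
`g ≥ 2` every solution is a real multiple of `i` (`exists_eq_smul_of_skewAdjoint`), so some `yi`
with `y²` rational acts on `Λ ⊗ ℚ`. This forces `τ` into `ℚ(yi)`, hence `𝔡 = 2`, and a scaled
standard Hermitian form is a polarization. -/

namespace ComplexTorus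

open Module MeasureTheory

variable {V : Type*} [NormedAddCommGroup V] [NormedSpace ℂ V]

/-! ### First Chern classes and factors of automorphy. -/

section ChernClass

/-- An alternating bilinear form on a free module is the antisymmetrization of a bilinear form. -/
theorem exists_bilinForm_sub_flip_eq {M ι : Type*} [AddCommGroup M] [Finite ι] (l : Basis ι ℤ M)
    (E : LinearMap.BilinForm ℤ M) (hE : E.IsAlt) :
    ∃ F : LinearMap.BilinForm ℤ M, ∀ x y, E x y = F x y - F y x := by
  obtain ⟨n, ⟨e⟩⟩ := Finite.exists_equiv_fin ι
  let F : LinearMap.BilinForm ℤ M :=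
    l.constr ℤ fun j => l.constr ℤ fun k => if e j < e k then E (l j) (l k) else 0
  have hF : ∀ j k, F (l j) (l k) = if e j < e k then E (l j) (l k) else 0 := by
    intro j k
    simp only [F, Basis.constr_basis]
  have h : E = F - F.flip := by
    refine LinearMap.ext_basis l l fun j k => ?_
    rw [LinearMap.sub_apply, LinearMap.sub_apply, show F.flip (l j) (l k) = F (l k) (l j) from rfl,
      hF, hF]
    rcases lt_trichotomy (e j) (e k) with h | h | h
    · simp [h, h.not_gt]
    · obtain rfl := e.injective h
      simpa using hE (l j)
    · simp [h, h.not_gt, ← hE.neg_eq (l k) (l j)]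
  refine ⟨F, fun x y => ?_⟩
  conv_lhs => rw [h]
  rfl

theorem IsChernClass.isAlt {Λ : Submodule ℤ V} {a : Λ → V → ℂˣ} {E : LinearMap.BilinForm ℤ Λ}
    (h : IsChernClass Λ a E) : E.IsAlt := by
  obtain ⟨f, -, -, hE⟩ := h
  intro x
  have := hE x x 0
  rw [← Int.cast_inj (α := ℂ), this]
  simp

/-- Write `E` as `F` minus its transpose. The affine functions `f x` then fail to be a cocycle
exactly by the integer `F x y`, which the exponential kills; the constant `(D x x + F x x) / 2` is
chosen for this. -/
theorem mem_neronSeveri_of_dual [FiniteDimensional ℂ V] {Λ : Submodule ℤ V} {ι : Type*} [Finite ι]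
    (l : Basis ι ℤ Λ) {E : LinearMap.BilinForm ℤ Λ} (D : Λ →ₗ[ℤ] Dual ℂ V)
    (hD : ∀ x y : Λ, (E x y : ℂ) = D y x - D x y) : E ∈ neronSeveri Λ := by
  have hE : E.IsAlt := fun x => by
    rw [← Int.cast_inj (α := ℂ), hD]
    simp
  obtain ⟨F, hF⟩ := exists_bilinForm_sub_flip_eq l E hE
  let f : Λ → V → ℂ := fun x v => D x v + (D x x + F x x) / 2
  have hf : ∀ x, Differentiable ℂ (f x) := fun x =>
    ((LinearMap.toContinuousLinearMap (D x)).differentiable).add_const _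
  have hfe : ∀ x y v, f (x + y) v = f x (v + y) + f y v + (F x y : ℂ) := by
    intro x y v
    have h1 := hD x y
    rw [hF x y] at h1
    simp only [f, map_add, LinearMap.add_apply, Submodule.coe_add]
    push_cast at h1 ⊢
    linear_combination -h1 / 2
  refine ⟨fun x v => Units.mk0 (Complex.exp (2 * Real.pi * Complex.I * f x v))
    (Complex.exp_ne_zero _), ⟨fun x => ?_, fun x y v => ?_⟩, f, hf, fun x v => rfl,
    fun x y v => ?_⟩
  · exact ((hf x).const_mul _).cexp
  · ext
    simp only [Units.val_mk0, Units.val_mul, ← Complex.exp_add]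
    rw [Complex.exp_eq_exp_iff_exists_int]
    exact ⟨F x y, by rw [hfe]; ring⟩
  · rw [hD]
    simp only [f, map_add]
    ring

/-- Cauchy's formula on the unit circle of the line through `v` in direction `w` writes the
derivative as an integral of a jointly continuous function. -/
theorem continuous_fderiv_apply [FiniteDimensional ℂ V] {f : V → ℂ} (hf : Differentiable ℂ f)
    (w : V) : Continuous fun v => fderiv ℂ f v w := by
  have h : ∀ v, fderiv ℂ f v w = (2 * Real.pi * Complex.I : ℂ)⁻¹ •
      ∮ z in C(0, 1), ((z - 0) ^ 2)⁻¹ • f (v + z • w) := by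
    intro v
    have hd : Differentiable ℂ fun z : ℂ => f (v + z • w) :=
      hf.comp ((differentiable_const v).add (differentiable_id.smul_const w))
    rw [Complex.two_pi_I_inv_smul_circleIntegral_sub_sq_inv_smul_of_differentiable isOpen_univ
      (Set.subset_univ _) hd.differentiableOn (Metric.mem_ball_self one_pos)]
    exact ((hf v).hasFDerivAt.hasLineDerivAt w).deriv.symm
  simp_rw [h, circleIntegral]
  refine Continuous.const_smul (M := ℂ) (α := ℂ) ?_ _
  refine intervalIntegral.continuous_parametric_intervalIntegral_of_continuous'
    (μ := volume) ?_ _ _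
  have hc : Continuous fun p : V × ℝ => circleMap (0 : ℂ) 1 p.2 :=
    (continuous_circleMap 0 1).comp continuous_snd
  simp only [Function.uncurry_def, deriv_circleMap]
  refine (hc.mul continuous_const).smul (Continuous.smul
    (Continuous.inv₀ ((hc.sub continuous_const).pow 2) ?_)
    (hf.continuous.comp (continuous_fst.add (hc.smul continuous_const))))
  intro p
  simp

section UnitCube

variable {ι : Type*} [Fintype ι]

/-- The uniform probability measure on the unit cube. -/
noncomputable def cubeMeasure (ι : Type*) [Fintype ι] : Measure (ι → ℝ) :=
  Measure.pi fun _ => volume.restrict (Set.Icc 0 1)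

instance : IsProbabilityMeasure (volume.restrict (Set.Icc (0 : ℝ) 1)) :=
  ⟨by simp⟩

instance : IsProbabilityMeasure (cubeMeasure ι) := by
  unfold cubeMeasure
  infer_instance

theorem integrable_cubeMeasure {h : (ι → ℝ) → ℂ} (hh : Continuous h) :
    Integrable h (cubeMeasure ι) := by
  rw [cubeMeasure, ← Measure.restrict_pi_pi (fun _ : ι => (volume : Measure ℝ))]
  exact hh.continuousOn.integrableOn_compact (isCompact_univ_pi fun _ => isCompact_Icc)

/-- Resampling one coordinate: the preimage of a box is a box whose `k`-th side is everything, of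
mass 1, times the side `s k`. -/
theorem measurePreserving_update [DecidableEq ι] (k : ι) :
    MeasurePreserving (fun p : (ι → ℝ) × ℝ => Function.update p.1 k p.2)
      ((cubeMeasure ι).prod (volume.restrict (Set.Icc 0 1))) (cubeMeasure ι) := by
  have hm : Measurable fun p : (ι → ℝ) × ℝ => Function.update p.1 k p.2 := by
    refine measurable_pi_lambda _ fun i => ?_
    by_cases h : i = k
    · subst h
      simpa using measurable_snd
    · simpa [h] using! (measurable_pi_apply i).comp measurable_fst
  refine ⟨hm, ?_⟩
  symm
  refine Measure.pi_eq fun s hs => ?_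
  rw [Measure.map_apply hm (MeasurableSet.univ_pi hs)]
  have : (fun p : (ι → ℝ) × ℝ => Function.update p.1 k p.2) ⁻¹' Set.univ.pi s =
      (Set.univ.pi (Function.update s k Set.univ)) ×ˢ s k := by
    ext p
    simp only [Set.mem_preimage, Set.mem_pi, Set.mem_univ, true_implies, Set.mem_prod]
    constructor
    · intro h
      refine ⟨fun i => ?_, by simpa using h k⟩
      by_cases hi : i = k
      · subst hi
        simp
      · simpa [hi] using h i
    · rintro ⟨h, hk⟩ i
      by_cases hi : i = k
      · subst hi
        simpa using hk
      · simpa [hi] using h i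
  rw [this, Measure.prod_prod, cubeMeasure, Measure.pi_pi,
    ← Finset.prod_erase_mul _ _ (Finset.mem_univ k),
    ← Finset.prod_erase_mul (a := k) (f := fun i => volume.restrict (Set.Icc 0 1) (s i)) _
      (Finset.mem_univ k)]
  congr 1
  rw [Function.update_self, measure_univ, mul_one]
  refine Finset.prod_congr rfl fun i hi => ?_
  rw [Function.update_of_ne (Finset.ne_of_mem_erase hi)]

theorem integral_cubeMeasure_eq [DecidableEq ι] (k : ι) {h : (ι → ℝ) → ℂ} (hh : Continuous h) :
    ∫ x, h x ∂cubeMeasure ι =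
      ∫ x, (∫ t in (0 : ℝ)..1, h (Function.update x k t)) ∂cubeMeasure ι := by
  have hp := measurePreserving_update (ι := ι) k
  rw [← hp.map_eq, integral_map hp.measurable.aemeasurable hh.aestronglyMeasurable,
    integral_prod]
  · rw [hp.map_eq]
    refine integral_congr_ae (ae_of_all _ fun x => ?_)
    simp only
    rw [intervalIntegral.integral_of_le zero_le_one, integral_Icc_eq_integral_Ioc]
  · exact (hp.integrable_comp hh.aestronglyMeasurable).2 (integrable_cubeMeasure hh)

/-- The mean over the unit cube of a directional derivative along an edge. -/
theorem integral_fderiv_update [DecidableEq ι] [FiniteDimensional ℂ V] {f : V → ℂ}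
    (hf : Differentiable ℂ f) (l : ι → V) {j k : ι} (hjk : j ≠ k) :
    ∫ x, fderiv ℂ f (∑ i, Function.update x j 0 i • l i) (l k) ∂cubeMeasure ι =
      ∫ x, (f (∑ i, Function.update (Function.update x j 0) k 0 i • l i + l k) -
        f (∑ i, Function.update (Function.update x j 0) k 0 i • l i)) ∂cubeMeasure ι := by
  have hc : Continuous fun x : ι → ℝ => ∑ i, Function.update x j 0 i • l i := by
    have hu : Continuous fun x : ι → ℝ => Function.update x j 0 :=
      continuous_id.update j continuous_const
    exact continuous_finsetSum _ fun i _ => ((continuous_apply i).comp hu).smul continuous_const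
  have hc' : Continuous fun x : ι → ℝ =>
      fderiv ℂ f (∑ i, Function.update x j 0 i • l i) (l k) :=
    (continuous_fderiv_apply hf (l k)).comp hc
  rw [integral_cubeMeasure_eq k hc']
  refine integral_congr_ae (ae_of_all _ fun x => ?_)
  set v : V := ∑ i, Function.update (Function.update x j 0) k 0 i • l i with hv
  have hup : ∀ t : ℝ, ∑ i, Function.update (Function.update x k t) j 0 i • l i = v + t • l k := by
    intro t
    rw [Function.update_comm hjk.symm, hv, ← Finset.add_sum_erase _ _ (Finset.mem_univ k),
      ← Finset.add_sum_erase (a := k) (f := fun i =>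
        Function.update (Function.update x j 0) k 0 i • l i) _ (Finset.mem_univ k)]
    simp only [Function.update_self, zero_smul, zero_add]
    rw [add_comm]
    congr 1
    refine Finset.sum_congr rfl fun i hi => ?_
    rw [Function.update_of_ne (Finset.ne_of_mem_erase hi),
      Function.update_of_ne (Finset.ne_of_mem_erase hi)]
  simp_rw [hup]
  have hl : Continuous fun t : ℝ => v + t • l k := by fun_prop
  -- The fundamental theorem of calculus along the edge `l k` leaves only the increment of `f`.
  rw [intervalIntegral.integral_eq_sub_of_hasDerivAt (f := fun t : ℝ => f (v + t • l k))]
  · simp [hv]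
  · intro t _
    have h1 : HasDerivAt (fun t : ℝ => v + t • l k) (l k) t := by
      simpa using ((hasDerivAt_id t).smul_const (l k)).const_add v
    exact ((hf (v + t • l k)).hasFDerivAt.restrictScalars ℝ).comp_hasDerivAt t h1
  · exact ((continuous_fderiv_apply hf (l k)).comp hl).intervalIntegrable _ _

end UnitCube

/-- A first Chern class on a complex torus is the antisymmetrization of a pairing that is
complex linear in one variable: the coefficients are the means of the differentials of the
logarithms of the factors of automorphy over the facets of a fundamental cell. -/
theorem exists_dual_of_mem_neronSeveri [FiniteDimensional ℂ V] {Λ : Submodule ℤ V} {ι : Type*}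
    [Finite ι] (l : ι → Λ) {E : LinearMap.BilinForm ℤ Λ} (hE : E ∈ neronSeveri Λ) :
    ∃ D : ι → Dual ℂ V, ∀ j k, (E (l j) (l k) : ℂ) = D k (l j) - D j (l k) := by
  classical
  obtain ⟨a, -, hEa⟩ := hE
  have halt := hEa.isAlt
  obtain ⟨f, hf, -, hE⟩ := hEa
  have := Fintype.ofFinite ι
  let φ : (ι → ℝ) → V := fun x => ∑ i, x i • (l i : V)
  have hφ : Continuous φ := by fun_prop
  have hc : ∀ j w, Continuous fun x : ι → ℝ =>
      fderiv ℂ (f (l j)) (φ (Function.update x j 0)) w := fun j w =>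
    (continuous_fderiv_apply (hf (l j)) w).comp
      (hφ.comp (continuous_id.update j continuous_const))
  let D : ι → Dual ℂ V := fun j =>
    { toFun := fun w => ∫ x, fderiv ℂ (f (l j)) (φ (Function.update x j 0)) w ∂cubeMeasure ι
      map_add' := fun w w' => by
        simp only [map_add]
        exact integral_add (integrable_cubeMeasure (hc j w)) (integrable_cubeMeasure (hc j w'))
      map_smul' := fun c w => by
        simp only [map_smul, RingHom.id_apply]
        exact integral_smul _ _ }
  refine ⟨D, fun j k => ?_⟩
  by_cases hjk : j = k
  · subst hjk
    simp [halt (l j)]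
  have hup : ∀ j k, Continuous fun x : ι → ℝ =>
      φ (Function.update (Function.update x j 0) k 0) := fun j k =>
    hφ.comp ((continuous_id.update j continuous_const).update k continuous_const)
  have hi : ∀ j k m, Integrable (fun x : ι → ℝ =>
      f m (φ (Function.update (Function.update x j 0) k 0) + l k) -
        f m (φ (Function.update (Function.update x j 0) k 0))) (cubeMeasure ι) := fun j k m =>
    integrable_cubeMeasure (((hf m).continuous.comp ((hup j k).add continuous_const)).sub
      ((hf m).continuous.comp (hup j k)))
  have h1 : D k (l j) = _ := integral_fderiv_update (hf (l k)) (fun i => (l i : V)) (Ne.symm hjk)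
  have h2 : D j (l k) = _ := integral_fderiv_update (hf (l j)) (fun i => (l i : V)) hjk
  rw [h1, h2, ← integral_sub (hi k j (l k)) (hi j k (l j))]
  -- At a point of the codimension-two face `x j = x k = 0`, the integrand is the Chern class
  -- formula itself, so it is constant and equals its mean.
  have : ∀ x : ι → ℝ, (f (l k) (φ (Function.update (Function.update x k 0) j 0) + l j) -
        f (l k) (φ (Function.update (Function.update x k 0) j 0))) -
      (f (l j) (φ (Function.update (Function.update x j 0) k 0) + l k) -
        f (l j) (φ (Function.update (Function.update x j 0) k 0))) = E (l j) (l k) := by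
    intro x
    rw [hE (l j) (l k) (φ (Function.update (Function.update x j 0) k 0)),
      Function.update_comm hjk]
    ring
  rw [integral_congr_ae (ae_of_all _ this)]
  simp

end ChernClass

/-! ### Forms of type (1,1) and the upper bound on the Picard number. -/

section HodgeForms

/-- The real alternating forms on `V` of Hodge type `(1, 1)`. -/
structure IsHodgeForm (F : LinearMap.BilinForm ℝ V) : Prop where
  isAlt : F.IsAlt
  apply_I_smul : ∀ v w, F (Complex.I • v) (Complex.I • w) = F v w

theorem IsHodgeForm.apply_I_smul_left {F : LinearMap.BilinForm ℝ V} (hF : IsHodgeForm F)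
    (v w : V) : F (Complex.I • v) w = F (Complex.I • w) v := by
  rw [← hF.apply_I_smul (Complex.I • v) w, smul_smul, Complex.I_mul_I, neg_smul, one_smul, map_neg,
    LinearMap.neg_apply, hF.isAlt.neg_eq]

variable {ι : Type*} [Fintype ι] [DecidableEq ι]

/-- The Gram matrices of the real alternating forms on `V` of Hodge type `(1, 1)`. -/
noncomputable def hodgeMatrices (lR : Basis ι ℝ V) : Submodule ℝ (Matrix ι ι ℝ) where
  carrier := {M | IsHodgeForm (Matrix.toBilin lR M)}
  zero_mem' := by
    simp only [Set.mem_ofPred_eq, map_zero]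
    exact ⟨fun _ => rfl, fun _ _ => rfl⟩
  add_mem' := fun ha hb => by
    simp only [Set.mem_ofPred_eq, map_add] at *
    exact ⟨ha.1.add hb.1, fun v w => by simp only [LinearMap.add_apply, ha.2 v w, hb.2 v w]⟩
  smul_mem' := fun c M hM => by
    simp only [Set.mem_ofPred_eq, map_smul] at *
    exact ⟨fun v => by simp [hM.1 v], fun v w => by simp only [LinearMap.smul_apply, hM.2 v w]⟩

/-- On a complex basis, `F(i·,·)` is symmetric and `F` antisymmetric, so their sum determines both;
together with type (1,1) they determine `F`. -/
theorem finrank_hodgeMatrices_le (lR : Basis ι ℝ V) {κ : Type*} [Fintype κ] (b : Basis κ ℂ V) :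
    finrank ℝ (hodgeMatrices lR) ≤ Fintype.card κ ^ 2 := by
  classical
  let T : hodgeMatrices lR →ₗ[ℝ] Matrix κ κ ℝ :=
    { toFun := fun M => Matrix.of fun j k => Matrix.toBilin lR M.1 (Complex.I • b j) (b k) +
        Matrix.toBilin lR M.1 (b j) (b k)
      map_add' := fun F F' => by
        ext j k
        simp only [Submodule.coe_add, map_add, LinearMap.add_apply, Matrix.of_apply,
          Matrix.add_apply]
        ring
      map_smul' := fun c F => by
        ext j k
        simp only [Submodule.coe_smul, map_smul, LinearMap.smul_apply, Matrix.of_apply,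
          Matrix.smul_apply, RingHom.id_apply, smul_eq_mul]
        ring }
  have hT : Function.Injective T := by
    rw [injective_iff_map_eq_zero]
    rintro ⟨M, hM⟩ h
    set F := Matrix.toBilin lR M with hFM
    have hF : IsHodgeForm F := hM
    have h1 : ∀ j k, F (Complex.I • b j) (b k) + F (b j) (b k) = 0 := fun j k =>
      congr_fun (congr_fun h j) k
    have h0 : ∀ j k, F (b j) (b k) = 0 := fun j k => by
      have := hF.1.neg_eq (b j) (b k)
      linarith [h1 j k, h1 k j, hF.apply_I_smul_left (b j) (b k)]
    have hI : ∀ j k, F (Complex.I • b j) (b k) = 0 := fun j k => by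
      linarith [h1 j k, h0 j k]
    have hI' : ∀ j k, F (b j) (Complex.I • b k) = 0 := fun j k => by
      rw [← hF.1.neg_eq, hI, neg_zero]
    let c : Basis (Fin 2 × κ) ℝ V := Complex.basisOneI.smulTower b
    have hF0 : F = 0 := by
      refine LinearMap.ext_basis c c ?_
      rintro ⟨s, j⟩ ⟨t, k⟩
      simp only [c, Basis.smulTower_apply, LinearMap.zero_apply]
      fin_cases s <;> fin_cases t <;> simp [h0, hI, hI', hF.2]
    rw [hFM, LinearEquiv.map_eq_zero_iff] at hF0
    exact Subtype.ext hF0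
  calc finrank ℝ (hodgeMatrices lR) ≤ finrank ℝ (Matrix κ κ ℝ) :=
        LinearMap.finrank_le_finrank_of_injective hT
    _ = Fintype.card κ ^ 2 := by simp [Module.finrank_matrix, sq]

variable {Λ : Submodule ℤ V}

/-- The Gram matrix of an integral bilinear form, with real coefficients. -/
noncomputable def realGram {M : Type*} [AddCommGroup M] (l : Basis ι ℤ M)
    (E : LinearMap.BilinForm ℤ M) : Matrix ι ι ℝ :=
  (LinearMap.BilinForm.toMatrix l E).map (Int.cast : ℤ → ℝ)

theorem realGram_apply {M : Type*} [AddCommGroup M] (l : Basis ι ℤ M)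
    (E : LinearMap.BilinForm ℤ M) (j k : ι) :
    realGram l E j k = E (l j) (l k) := by
  rw [realGram, Matrix.map_apply, LinearMap.BilinForm.toMatrix_apply]

theorem toBilin_apply_basis (lR : Basis ι ℝ V) (M : Matrix ι ι ℝ) (j k : ι) :
    Matrix.toBilin lR M (lR j) (lR k) = M j k := by
  rw [← LinearMap.BilinForm.toMatrix_apply lR, LinearMap.BilinForm.toMatrix_toBilin]

/-- The real extension is `F(v,w) = T_w(v) - T_v(w)` with each `T_v` complex linear, so it has no
part antilinear in both variables. The identity `h` states this, and as `F` is real its real part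
gives type (1,1). -/
theorem realGram_mem_hodgeMatrices [FiniteDimensional ℂ V] (l : Basis ι ℤ Λ) (lR : Basis ι ℝ V)
    (hl : ∀ j, lR j = l j) {E : LinearMap.BilinForm ℤ Λ} (hE : E ∈ neronSeveri Λ) :
    realGram l E ∈ hodgeMatrices lR := by
  obtain ⟨D, hD⟩ := exists_dual_of_mem_neronSeveri l hE
  let T : V →ₗ[ℝ] Dual ℂ V := lR.constr ℝ D
  let F := Matrix.toBilin lR (realGram l E)
  let T₂ : V →ₗ[ℝ] V →ₗ[ℝ] ℂ := LinearMap.mk₂ ℝ (fun v w => T v w) (by simp) (by simp) (by simp)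
    (by simp)
  let F₂ : V →ₗ[ℝ] V →ₗ[ℝ] ℂ := LinearMap.mk₂ ℝ (fun v w => (F v w : ℂ)) (by simp) (by simp)
    (by simp) (by simp)
  have hFT : F₂ = T₂.flip - T₂ := by
    refine LinearMap.ext_basis lR lR fun j k => ?_
    change (F (lR j) (lR k) : ℂ) = T (lR k) (lR j) - T (lR j) (lR k)
    rw [toBilin_apply_basis, realGram_apply, Basis.constr_basis, Basis.constr_basis, hl, hl]
    exact_mod_cast hD j k
  have hF : ∀ v w, (F v w : ℂ) = T w v - T v w := fun v w =>
    congr_arg (fun B : V →ₗ[ℝ] V →ₗ[ℝ] ℂ => B v w) hFT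
  refine ⟨fun v => ?_, fun v w => ?_⟩
  · have := hF v v
    rw [sub_self] at this
    exact_mod_cast this
  · have h : (F v w : ℂ) - F (Complex.I • v) (Complex.I • w) +
        Complex.I * (F (Complex.I • v) w + F v (Complex.I • w)) = 0 := by
      simp only [hF, map_smul, smul_eq_mul]
      linear_combination (T w v - T v w) * Complex.I_mul_I
    have h' := congr_arg Complex.re h
    simp at h'
    exact (sub_eq_zero.1 h').symm

theorem exists_ratDual_ne_zero {c : ℝ} (hc : c ≠ 0) : ∃ φ : ℝ →ₗ[ℚ] ℚ, φ c ≠ 0 := by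
  by_contra! h
  exact hc ((Module.forall_dual_apply_eq_zero_iff ℚ c).1 h)

/-- Integral matrices that are independent over the integers are independent over the reals. -/
theorem linearIndependent_map_intCast {m n κ : Type*} {A : κ → Matrix m n ℤ}
    (hA : LinearIndependent ℤ A) : LinearIndependent ℝ fun a => (A a).map (Int.cast : ℤ → ℝ) := by
  have hQ : LinearIndependent ℚ fun a => (A a).map (Int.cast : ℤ → ℚ) := by
    rw [← LinearIndependent.iff_fractionRing ℤ ℚ]
    let T : Matrix m n ℤ →ₗ[ℤ] Matrix m n ℚ := ((Int.castAddHom ℚ).mapMatrix).toIntLinearMap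
    refine hA.map' T (LinearMap.ker_eq_bot.2 fun M N h => ?_)
    ext i j
    exact Int.cast_injective (congr_fun (congr_fun h i) j)
  rw [linearIndependent_iff'] at hQ ⊢
  intro s c hc a ha
  by_contra hne
  obtain ⟨φ, hφ⟩ := exists_ratDual_ne_zero hne
  -- A ℚ-linear functional turns a real relation among integral matrices into a rational one whose
  -- coefficient at `a` is still nonzero.
  refine hφ (hQ s (fun a => φ (c a)) ?_ a ha)
  ext i j
  have h := congr_arg φ (congr_fun (congr_fun hc i) j)
  simp only [Matrix.sum_apply, Matrix.smul_apply, Matrix.map_apply, Matrix.zero_apply, map_sum,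
    map_zero, smul_eq_mul] at h ⊢
  rw [← h]
  refine Finset.sum_congr rfl fun a _ => ?_
  rw [mul_comm (c a), ← zsmul_eq_mul, map_zsmul, zsmul_eq_mul, mul_comm]

/-- A basis of the Néron-Severi group gives independent forms of type `(1, 1)`. -/
theorem exists_linearIndependent_realGram (l : Basis ι ℤ Λ) :
    ∃ E : Fin (picardNumber Λ) → LinearMap.BilinForm ℤ Λ, (∀ a, E a ∈ neronSeveri Λ) ∧
      LinearIndependent ℝ fun a => realGram l (E a) := by
  let T : neronSeveri Λ →ₗ[ℤ] Matrix ι ι ℤ :=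
    (LinearMap.BilinForm.toMatrix l).toLinearMap.comp
      (neronSeveri Λ).subtype.toIntLinearMap
  have hT : Function.Injective T :=
    (LinearMap.BilinForm.toMatrix l).injective.comp Subtype.val_injective
  let e := LinearEquiv.ofInjective T hT
  have hN : finrank ℤ (LinearMap.range T) = picardNumber Λ := e.finrank_eq.symm
  let B : Basis (Fin (picardNumber Λ)) ℤ (LinearMap.range T) :=
    Module.finBasisOfFinrankEq ℤ _ hN
  refine ⟨fun a => (e.symm (B a)).1, fun a => (e.symm (B a)).2, ?_⟩
  have h1 : LinearIndependent ℤ fun a => (B a).1 :=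
    B.linearIndependent.map' (LinearMap.range T).subtype (Submodule.ker_subtype _)
  have h2 : (fun a => realGram l (e.symm (B a)).1) =
      fun a => (B a).1.map (Int.cast : ℤ → ℝ) := by
    ext1 a
    have : (B a).1 = T (e.symm (B a)) := by
      rw [← LinearEquiv.ofInjective_apply (h := hT)]
      exact congr_arg _ (e.apply_symm_apply (B a)).symm
    rw [this]
    rfl
  rw [h2]
  exact linearIndependent_map_intCast h1

theorem picardNumber_le [FiniteDimensional ℂ V] (l : Basis ι ℤ Λ) (lR : Basis ι ℝ V)
    (hl : ∀ j, lR j = l j) {κ : Type*} [Fintype κ] (b : Basis κ ℂ V) :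
    picardNumber Λ ≤ Fintype.card κ ^ 2 := by
  obtain ⟨E, hE, hli⟩ := exists_linearIndependent_realGram l
  have h : LinearIndependent ℝ fun a =>
      (⟨_, realGram_mem_hodgeMatrices l lR hl (hE a)⟩ : hodgeMatrices lR) :=
    LinearIndependent.of_comp (hodgeMatrices lR).subtype hli
  simpa using h.fintype_card_le_finrank.trans (finrank_hodgeMatrices_le lR b)

/-- If the Picard number is maximal, the Néron-Severi group spans the forms of type `(1, 1)`. -/
theorem hodgeMatrices_le_span_of_picardNumber_eq [FiniteDimensional ℂ V] (l : Basis ι ℤ Λ)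
    (lR : Basis ι ℝ V) (hl : ∀ j, lR j = l j) {κ : Type*} [Fintype κ] (b : Basis κ ℂ V)
    (hρ : picardNumber Λ = Fintype.card κ ^ 2) :
    hodgeMatrices lR ≤ Submodule.span ℝ (realGram l '' neronSeveri Λ) := by
  obtain ⟨E, hE, hli⟩ := exists_linearIndependent_realGram l
  have hle : Submodule.span ℝ (Set.range fun a => realGram l (E a)) ≤ hodgeMatrices lR := by
    rw [Submodule.span_le]
    rintro _ ⟨a, rfl⟩
    exact realGram_mem_hodgeMatrices l lR hl (hE a)
  have heq := Submodule.eq_of_le_of_finrank_le hle (by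
    rw [finrank_span_eq_card hli, Fintype.card_fin, hρ]
    exact finrank_hodgeMatrices_le lR b)
  rw [← heq]
  refine Submodule.span_mono ?_
  rintro _ ⟨a, rfl⟩
  exact ⟨E a, hE a, rfl⟩

end HodgeForms

/-! ### Endomorphisms skew for all (1,1)-forms, and the rational action of an imaginary number. -/

section SkewAdjoint

/-- The imaginary part of the Hermitian form `ℓ v * conj (ℓ w)`. -/
noncomputable def imHermitianSq (ℓ : Dual ℂ V) : LinearMap.BilinForm ℝ V :=
  LinearMap.mk₂ ℝ (fun v w => (ℓ v * starRingEnd ℂ (ℓ w)).im)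
    (fun _ _ _ => by simp only [map_add, add_mul, Complex.add_im])
    (fun c v w => by
      rw [← Complex.coe_smul, map_smul]
      simp
      ring)
    (fun _ _ _ => by simp only [map_add, mul_add, Complex.add_im])
    (fun c v w => by
      rw [← Complex.coe_smul, map_smul]
      simp
      ring)

theorem imHermitianSq_apply (ℓ : Dual ℂ V) (v w : V) :
    imHermitianSq ℓ v w = (ℓ v * starRingEnd ℂ (ℓ w)).im := rfl

theorem isHodgeForm_imHermitianSq (ℓ : Dual ℂ V) : IsHodgeForm (imHermitianSq ℓ) := by
  refine ⟨fun v => ?_, fun v w => ?_⟩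
  · rw [imHermitianSq_apply, Complex.mul_conj, Complex.ofReal_im]
  · simp only [imHermitianSq_apply, map_smul, smul_eq_mul, map_mul, Complex.conj_I]
    congr 1
    linear_combination (-ℓ v * starRingEnd ℂ (ℓ w)) * Complex.I_mul_I

/-- A real endomorphism that is skew-adjoint for all forms of type `(1, 1)` is multiplication
by an imaginary number. -/
theorem exists_eq_smul_of_skewAdjoint {κ : Type*} [Nontrivial κ] (b : Basis κ ℂ V)
    (T : V →ₗ[ℝ] V) (hT : ∀ F : LinearMap.BilinForm ℝ V, IsHodgeForm F →
      ∀ v w, F (T v) w = -F v (T w)) : ∃ y : ℝ, ∀ v, T v = (y * Complex.I) • v := by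
  -- Pairing with `w = i T v` in the rank-one form of `ℓ` gives `|ℓ(T v)|² = 0`. Hence `T` preserves
  -- every complex line.
  have hker : ∀ (v : V) (ℓ : Dual ℂ V), ℓ v = 0 → ℓ (T v) = 0 := by
    intro v ℓ hv
    have h := hT _ (isHodgeForm_imHermitianSq ℓ) v (Complex.I • T v)
    simp only [imHermitianSq_apply, hv, map_smul, smul_eq_mul, zero_mul, Complex.zero_im,
      neg_zero] at h
    rw [map_mul, mul_left_comm, Complex.mul_conj, Complex.conj_I] at h
    simpa using h
  have hspan : ∀ v, ∃ c : ℂ, T v = c • v := by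
    intro v
    by_contra! hv
    have : T v ∉ Submodule.span ℂ {v} := fun h => by
      obtain ⟨c, hc⟩ := Submodule.mem_span_singleton.1 h
      exact hv c hc.symm
    obtain ⟨ℓ, hℓ, hle⟩ := Submodule.exists_le_ker_of_notMem this
    exact hℓ (hker v ℓ (hle (Submodule.mem_span_singleton_self v)))
  choose c hc using hspan
  -- Comparing coordinates in `s b_j + b_k` makes the scalar independent of the vector; two basis
  -- vectors are needed, whence `g ≥ 2`.
  have hind : ∀ (j k : κ) (s : ℂ), s ≠ 0 → j ≠ k → c (s • b j) = c (b k) := by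
    intro j k s hs hjk
    have h1 := hc (s • b j + b k)
    rw [map_add, hc, hc (b k)] at h1
    have h2 := congr_arg (fun v => b.repr v j) h1
    have h3 := congr_arg (fun v => b.repr v k) h1
    simp [hjk, hjk.symm] at h2 h3
    rw [h3]
    exact h2.resolve_right hs
  obtain ⟨j₀, k₀, hjk₀⟩ := exists_pair_ne κ
  have hconst : ∀ (j : κ) (s : ℂ), s ≠ 0 → c (s • b j) = c (b j₀) := by
    intro j s hs
    by_cases hj : j = j₀
    · subst hj
      rw [hind j k₀ s hs hjk₀, ← hind j k₀ 1 one_ne_zero hjk₀, one_smul]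
    · exact hind j j₀ s hs hj
  have hTc : ∀ v, T v = c (b j₀) • v := by
    let S : V →ₗ[ℝ] V := (LinearMap.lsmul ℂ V (c (b j₀))).restrictScalars ℝ
    have : T = S := by
      refine (Complex.basisOneI.smulTower b).ext ?_
      rintro ⟨s, j⟩
      rw [Basis.smulTower_apply, hc, hconst]
      · rfl
      · fin_cases s <;> simp
    intro v
    rw [this]
    rfl
  have hre : (c (b j₀)).re = 0 := by
    have h := hT _ (isHodgeForm_imHermitianSq (b.coord j₀)) (b j₀) (Complex.I • b j₀)
    simp only [imHermitianSq_apply, hTc] at h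
    simp at h
    linarith
  refine ⟨(c (b j₀)).im, fun v => ?_⟩
  rw [hTc]
  congr 1
  apply Complex.ext <;> simp [hre]

variable {ι : Type*} [Fintype ι] [DecidableEq ι]

theorem skewAdjoint_toBilin_iff (lR : Basis ι ℝ V) (M : Matrix ι ι ℝ) (T : V →ₗ[ℝ] V) :
    (∀ v w, Matrix.toBilin lR M (T v) w = -Matrix.toBilin lR M v (T w)) ↔
      (LinearMap.toMatrix lR lR T).transpose * M = -(M * LinearMap.toMatrix lR lR T) := by
  set F := Matrix.toBilin lR M with hF
  have hM : M = LinearMap.BilinForm.toMatrix lR F :=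
    (LinearMap.BilinForm.toMatrix_toBilin lR M).symm
  rw [hM, ← LinearMap.BilinForm.toMatrix_compLeft, ← LinearMap.BilinForm.toMatrix_compRight,
    ← map_neg, EmbeddingLike.apply_eq_iff_eq]
  constructor
  · intro h
    ext v w
    exact h v w
  · intro h v w
    exact congr_arg (fun B : LinearMap.BilinForm ℝ V => B v w) h

/-- Multiplication by `I` as a real endomorphism. -/
noncomputable def mulI (V : Type*) [NormedAddCommGroup V] [NormedSpace ℂ V] : V →ₗ[ℝ] V :=
  (LinearMap.lsmul ℂ V Complex.I).restrictScalars ℝ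

theorem mulI_apply (v : V) : mulI V v = Complex.I • v := rfl

theorem IsHodgeForm.skewAdjoint_mulI {F : LinearMap.BilinForm ℝ V} (hF : IsHodgeForm F) (v w : V) :
    F (mulI V v) w = -F v (mulI V w) := by
  rw [mulI_apply, mulI_apply, hF.apply_I_smul_left, hF.isAlt.neg_eq]

variable {Λ : Submodule ℤ V}

/-- If the Picard number is maximal, then a nonzero imaginary number, whose square is rational,
acts on the rational span of the lattice. -/
theorem exists_rational_smul [FiniteDimensional ℂ V] (l : Basis ι ℤ Λ) (lR : Basis ι ℝ V)
    (hl : ∀ j, lR j = l j) {κ : Type*} [Fintype κ] [Nontrivial κ] (b : Basis κ ℂ V)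
    (hρ : picardNumber Λ = Fintype.card κ ^ 2) :
    ∃ (y : ℝ) (q : ℚ) (R : Matrix ι ι ℚ), y ≠ 0 ∧ y ^ 2 = q ∧
      ∀ k, (y * Complex.I) • lR k = ∑ j, (R j k : ℝ) • lR j := by
  set J := LinearMap.toMatrix lR lR (mulI V) with hJ
  have hJJ : J * J = -1 := by
    rw [hJ, ← LinearMap.toMatrix_mul, ← LinearMap.toMatrix_one lR, ← map_neg]
    congr 1
    ext v
    simp [mulI_apply, smul_smul]
  obtain ⟨j, k, hjk⟩ : ∃ j k, J j k ≠ 0 := by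
    by_contra! h
    have hJ0 : J = 0 := by
      ext j k
      exact h j k
    rw [hJ, LinearEquiv.map_eq_zero_iff] at hJ0
    obtain ⟨i⟩ := (inferInstance : Nonempty κ)
    have := congr_arg (fun S : V →ₗ[ℝ] V => S (b i)) hJ0
    simp [mulI_apply, b.ne_zero] at this
  obtain ⟨φ, hφ⟩ := exists_ratDual_ne_zero hjk
  let R : Matrix ι ι ℚ := J.map φ
  let S : Matrix ι ι ℝ := R.map (Rat.cast : ℚ → ℝ)
  -- For an integral Gram matrix the equation is linear in `J` over the integers, so `φ` carries it
  -- over to `R`; these matrices span by maximality.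
  have hskew : ∀ M ∈ hodgeMatrices lR, S.transpose * M = -(M * S) := by
    intro M hM
    have hM' := hodgeMatrices_le_span_of_picardNumber_eq l lR hl b hρ hM
    clear hM
    induction hM' using Submodule.span_induction with
    | mem M hM =>
      obtain ⟨E, hE, rfl⟩ := hM
      have h := (skewAdjoint_toBilin_iff lR _ _).1 (IsHodgeForm.skewAdjoint_mulI
        (realGram_mem_hodgeMatrices l lR hl hE))
      ext p q
      have h' := congr_arg φ (congr_fun (congr_fun h p) q)
      simp only [Matrix.mul_apply, Matrix.neg_apply, Matrix.transpose_apply, map_sum, map_neg,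
        realGram_apply, ← hJ] at h'
      have hz : ∀ (n : ℤ) (r : ℝ), φ (n * r) = n * φ r := fun n r => by
        rw [← zsmul_eq_mul, map_zsmul, zsmul_eq_mul]
      simp only [fun r (n : ℤ) => mul_comm r (n : ℝ), hz] at h'
      simp only [Matrix.mul_apply, Matrix.neg_apply, Matrix.transpose_apply, realGram_apply, S, R,
        Matrix.map_apply]
      simp only [fun r (n : ℤ) => mul_comm r (n : ℝ)]
      exact_mod_cast h'
    | zero => simp
    | add M N _ _ hM hN => rw [mul_add, hM, hN, add_mul, neg_add]
    | smul c M _ hM => rw [Matrix.mul_smul, hM, Matrix.smul_mul, smul_neg]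
  let T := Matrix.toLin lR lR S
  have hTS : LinearMap.toMatrix lR lR T = S := LinearMap.toMatrix_toLin lR lR S
  obtain ⟨y, hy⟩ := exists_eq_smul_of_skewAdjoint b T (by
    intro F hF
    have hFM : Matrix.toBilin lR (LinearMap.BilinForm.toMatrix lR F) = F :=
      Matrix.toBilin_toMatrix lR F
    have hmem : LinearMap.BilinForm.toMatrix lR F ∈ hodgeMatrices lR := by
      change IsHodgeForm _
      rwa [hFM]
    have := (skewAdjoint_toBilin_iff lR (LinearMap.BilinForm.toMatrix lR F) T).2
      (by rw [hTS]; exact hskew _ hmem)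
    rwa [hFM] at this)
  have hSJ : S = y • J := by
    rw [← hTS, hJ, ← map_smul]
    congr 1
    ext v
    rw [hy, LinearMap.smul_apply, mulI_apply, mul_smul, Complex.coe_smul]
  -- From `S = yJ` and `J² = -1` follows `S² = -y²`, so `y²` is read off a diagonal entry of the
  -- rational matrix `R²`.
  refine ⟨y, -(R * R) j j, R, ?_, ?_, fun i => ?_⟩
  · rintro rfl
    rw [zero_smul] at hSJ
    have := congr_fun (congr_fun hSJ j) k
    simp only [S, R, Matrix.map_apply, Matrix.zero_apply, Rat.cast_eq_zero] at this
    exact hφ this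
  · have h : S * S = -y ^ 2 • (1 : Matrix ι ι ℝ) := by
      rw [hSJ, Matrix.smul_mul, Matrix.mul_smul, hJJ, smul_smul, smul_neg, neg_smul, sq]
    have h' := congr_fun (congr_fun h j) j
    simp only [Matrix.smul_apply, Matrix.one_apply_eq, smul_eq_mul, mul_one] at h'
    rw [eq_neg_of_add_eq_zero_left (a := y ^ 2) (b := (S * S) j j) (by linarith)]
    simp only [S, Matrix.mul_apply, Matrix.map_apply]
    push_cast
    rfl
  · rw [← hy, Matrix.toLin_self]
    rfl

end SkewAdjoint

/-! ### Hermitian forms and polarizations. -/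

section Polarization

variable {Λ : Submodule ℤ V}

/-- The functionals `H(·, y) / 2i` are complex linear and antisymmetrize to `Im H`. -/
theorem mem_neronSeveri_of_hermitian [FiniteDimensional ℂ V] {ι : Type*} [Finite ι]
    (l : Basis ι ℤ Λ) {E : LinearMap.BilinForm ℤ Λ} (H : V →ₗ[ℂ] V →ₗ⋆[ℂ] ℂ)
    (hH : ∀ v w, H w v = starRingEnd ℂ (H v w)) (hE : ∀ x y : Λ, (H x y).im = E x y) :
    E ∈ neronSeveri Λ := by
  let D : Λ →ₗ[ℤ] Dual ℂ V :=
    (AddMonoidHom.mk' (fun y : Λ => (2 * Complex.I)⁻¹ • H.flip (y : V)) (by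
      intro x y
      simp)).toIntLinearMap
  refine mem_neronSeveri_of_dual l D fun x y => ?_
  change (E x y : ℂ) = (2 * Complex.I)⁻¹ * H x y - (2 * Complex.I)⁻¹ * H y x
  have h : ((H x y).im : ℂ) = E x y := by
    rw [hE]
    simp
  rw [hH x y, ← mul_sub, Complex.sub_conj, ← h]
  push_cast
  field_simp

theorem exists_common_denominator {σ : Type*} [Fintype σ] (r : σ → ℚ) :
    ∃ N : ℕ, 0 < N ∧ ∀ s, ∃ m : ℤ, (m : ℚ) = N * r s := by
  classical
  refine ⟨∏ s, (r s).den, Finset.prod_pos fun s _ => (r s).pos, fun s => ?_⟩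
  refine ⟨(∏ t ∈ Finset.univ.erase s, ((r t).den : ℤ)) * (r s).num, ?_⟩
  rw [← Finset.prod_erase_mul _ _ (Finset.mem_univ s)]
  push_cast
  rw [mul_assoc, Rat.den_mul_eq_num]

variable {κ ι : Type*} [Fintype κ] [Fintype ι]

/-- A complex torus all of whose periods are in an imaginary quadratic field is an abelian
variety. -/
theorem isAbelianVariety_of_imaginary_quadratic (b : Basis κ ℂ V) (l : Basis ι ℤ Λ) {y : ℝ}
    (hy : 0 < y) (A B : ι → κ → ℚ)
    (hl : ∀ p i, b.repr (l p) i = A p i + B p i * (y * Complex.I)) : IsAbelianVariety Λ := by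
  have := b.finiteDimensional_of_finite
  obtain ⟨N, hN, hNint⟩ := exists_common_denominator
    (Sum.elim (fun s : ι × κ => A s.1 s.2) fun s : ι × κ => B s.1 s.2)
  choose m hm using hNint
  let α : ι → κ → ℤ := fun p i => m (Sum.inl (p, i))
  let β : ι → κ → ℤ := fun p i => m (Sum.inr (p, i))
  have hα : ∀ p i, (α p i : ℂ) = N * A p i := fun p i => by
    have := congr_arg (Rat.cast : ℚ → ℂ) (hm (Sum.inl (p, i)))
    simpa using! this
  have hβ : ∀ p i, (β p i : ℂ) = N * B p i := fun p i => by
    have := congr_arg (Rat.cast : ℚ → ℂ) (hm (Sum.inr (p, i)))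
    simpa using! this
  have hN0 : (N : ℂ) ≠ 0 := by exact_mod_cast hN.ne'
  have hy0 : (y : ℂ) ≠ 0 := by exact_mod_cast hy.ne'
  -- On lattice vectors the standard Hermitian form has imaginary part in `(y / N²) ℤ`; this factor
  -- makes it integral.
  let c : ℝ := N ^ 2 / y
  have hc : 0 < c := by positivity
  let H : V →ₗ[ℂ] V →ₗ⋆[ℂ] ℂ := LinearMap.mk₂'ₛₗ (RingHom.id ℂ) (starRingEnd ℂ)
    (fun v w => c * ∑ i, b.repr v i * starRingEnd ℂ (b.repr w i))
    (fun _ _ _ => by simp [add_mul, Finset.sum_add_distrib, mul_add])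
    (fun s _ _ => by simp [mul_assoc, Finset.mul_sum, mul_left_comm])
    (fun _ _ _ => by simp [mul_add, Finset.sum_add_distrib])
    (fun s _ _ => by simp [Finset.mul_sum, mul_left_comm])
  have hH : ∀ v w, H v w = c * ∑ i, b.repr v i * starRingEnd ℂ (b.repr w i) := fun _ _ => rfl
  let E : LinearMap.BilinForm ℤ Λ :=
    l.constr ℤ fun p => l.constr ℤ fun q => ∑ i, (β p i * α q i - α p i * β q i)
  have hE : ∀ v w : Λ, (H v w).im = E v w := by
    let H₂ : Λ →ₗ[ℤ] Λ →ₗ[ℤ] ℝ := LinearMap.mk₂ ℤ (fun v w => (H v w).im) (by simp) (by simp)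
      (by simp) (by simp)
    let E₂ : Λ →ₗ[ℤ] Λ →ₗ[ℤ] ℝ := LinearMap.mk₂ ℤ (fun v w => (E v w : ℝ)) (by simp) (by simp)
      (by simp) (by simp)
    have : H₂ = E₂ := by
      refine LinearMap.ext_basis l l fun p q => ?_
      change (H (l p) (l q)).im = (E (l p) (l q) : ℝ)
      have hlN : ∀ p i, b.repr (l p) i = (α p i + β p i * (y * Complex.I)) / N := by
        intro p i
        rw [hl, hα, hβ]
        field_simp
      simp only [E, Basis.constr_basis, hH, Complex.im_ofReal_mul,
        Complex.im_sum]
      push_cast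
      rw [Finset.mul_sum]
      refine Finset.sum_congr rfl fun i _ => ?_
      have h1 : b.repr (l p) i * starRingEnd ℂ (b.repr (l q) i) =
          (((α p i * α q i + β p i * β q i * y ^ 2) / N ^ 2 : ℝ) : ℂ) +
            (((β p i * α q i - α p i * β q i) * y / N ^ 2 : ℝ) : ℂ) * Complex.I := by
        rw [hlN, hlN]
        simp only [map_div₀, map_add, map_mul, Complex.conj_I, Complex.conj_ofReal, map_natCast,
          map_intCast]
        push_cast
        field_simp
        linear_combination (-(β p i : ℂ) * β q i * y ^ 2) * Complex.I_sq
      rw [h1]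
      simp only [Complex.add_im, Complex.ofReal_im, Complex.mul_im, Complex.ofReal_re,
        Complex.I_im, Complex.I_re, c]
      field_simp
      ring
    exact fun v w => congr_arg (fun F : Λ →ₗ[ℤ] Λ →ₗ[ℤ] ℝ => F v w) this
  have hsymm : ∀ v w, H w v = starRingEnd ℂ (H v w) := by
    intro v w
    simp only [hH, map_mul, map_sum, Complex.conj_ofReal, Complex.conj_conj]
    simp only [mul_comm]
  refine ⟨E, mem_neronSeveri_of_hermitian l H hsymm hE, H, hsymm, fun v hv => ?_, hE⟩
  rw [hH, Complex.re_ofReal_mul, Complex.re_sum]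
  refine mul_pos hc ?_
  simp only [Complex.mul_conj, Complex.ofReal_re]
  obtain ⟨i, hi⟩ : ∃ i, b.repr v i ≠ 0 := by
    by_contra! h
    exact hv (b.ext_elem (by simpa using h))
  exact Finset.sum_pos' (fun i _ => Complex.normSq_nonneg _)
    ⟨i, Finset.mem_univ i, Complex.normSq_pos.2 hi⟩

end Polarization

/-! ### The Riemann relation and the lower bound on the Picard number. -/

section LowerBound

variable {Λ : Submodule ℤ V}

section RiemannRelation

variable {κ : Type*} [Fintype κ]

/-- The obstruction for the alternating form with blocks `A`, `B`, `C` to be of type `(1, 1)`. -/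
def riemannRelation {K : Type*} [CommRing K] (τ : Matrix κ κ K) (A B C : Matrix κ κ K) :
    Matrix κ κ K :=
  A - B * τ + τ.transpose * B.transpose + τ.transpose * C * τ

theorem riemannRelation_transpose {K : Type*} [CommRing K] (τ : Matrix κ κ K) {A B C : Matrix κ κ K}
    (hA : A.transpose = -A) (hC : C.transpose = -C) :
    (riemannRelation τ A B C).transpose = -riemannRelation τ A B C := by
  simp only [riemannRelation, Matrix.transpose_add, Matrix.transpose_sub, Matrix.transpose_mul,
    Matrix.transpose_transpose, hA, hC, neg_add, Matrix.mul_assoc, Matrix.neg_mul, Matrix.mul_neg]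
  abel

theorem riemannRelation_map {K L : Type*} [CommRing K] [CommRing L] (f : K →+* L)
    (τ A B C : Matrix κ κ K) :
    (riemannRelation τ A B C).map f = riemannRelation (τ.map f) (A.map f) (B.map f) (C.map f) := by
  simp only [riemannRelation, ← Matrix.transpose_map, Matrix.map_add f (map_add f),
    Matrix.map_sub f (map_sub f), Matrix.map_mul]

/-- The Riemann relation puts an integral alternating form in the Néron-Severi group. -/
theorem mem_neronSeveri_of_riemannRelation (b : Basis κ ℂ V) [DecidableEq κ]
    (l : Basis (κ ⊕ κ) ℤ Λ) (τ : Matrix κ κ ℂ)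
    (hl : ∀ p i, b.repr (l p) i = Matrix.fromCols τ 1 i p) {E : LinearMap.BilinForm ℤ Λ}
    {A B C : Matrix κ κ ℤ}
    (hE : LinearMap.BilinForm.toMatrix l E = Matrix.fromBlocks A B (-B.transpose) C)
    (hC : C.transpose = -C)
    (hR : riemannRelation τ (A.map (Int.castRingHom ℂ)) (B.map (Int.castRingHom ℂ))
      (C.map (Int.castRingHom ℂ)) = 0) : E ∈ neronSeveri Λ := by
  have := b.finiteDimensional_of_finite
  set A' := A.map (Int.castRingHom ℂ) with hA'
  set B' := B.map (Int.castRingHom ℂ) with hB'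
  set C' := C.map (Int.castRingHom ℂ) with hC'
  have hCt : C'.transpose = -C' := by
    rw [hC', ← Matrix.transpose_map, hC]
    ext
    simp
  -- `P` and `Q` hold the coordinates of the functionals. The block equations `C = Qᵗ - Q` and `B =
  -- (Qτ)ᵗ - P` are solved by this choice; the remaining one, `A = (Pτ)ᵗ - Pτ`, is the Riemann
  -- relation.
  let Q : Matrix κ κ ℂ := (-1 / 2 : ℂ) • C'
  let P : Matrix κ κ ℂ := (Q * τ).transpose - B'
  let D : Λ →ₗ[ℤ] Dual ℂ V :=
    l.constr ℤ (Sum.elim (fun j => b.constr ℂ (P j)) fun j => b.constr ℂ (Q j))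
  have hDP : ∀ p q, D (l (Sum.inl q)) (l p) = ∑ i, P q i * Matrix.fromCols τ 1 i p := by
    intro p q
    simp [D, ← hl, Basis.constr_apply_fintype, mul_comm]
  have hDQ : ∀ p q, D (l (Sum.inr q)) (l p) = ∑ i, Q q i * Matrix.fromCols τ 1 i p := by
    intro p q
    simp [D, ← hl, Basis.constr_apply_fintype, mul_comm]
  have hAeq : A' = (P * τ).transpose - P * τ := by
    rw [riemannRelation] at hR
    have h2 : τ.transpose * (C' * τ) = -τ.transpose * (Q.transpose.transpose * τ) +
        τ.transpose * (Q.transpose * τ) := by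
      rw [Matrix.neg_mul, ← Matrix.mul_neg, ← Matrix.mul_add, ← Matrix.neg_mul, ← Matrix.add_mul]
      congr 2
      simp only [Q, Matrix.transpose_smul, hCt, Matrix.transpose_neg, neg_neg]
      module
    rw [Matrix.mul_assoc τ.transpose, h2] at hR
    simp only [P, Matrix.transpose_mul, Matrix.transpose_sub, Matrix.sub_mul,
      Matrix.transpose_transpose, Matrix.mul_assoc, Matrix.neg_mul] at hR ⊢
    rw [← sub_eq_zero, ← hR]
    abel
  have hbasis : ∀ p q, (E (l p) (l q) : ℂ) = D (l q) (l p) - D (l p) (l q) := by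
    intro p q
    rw [← LinearMap.BilinForm.toMatrix_apply, hE]
    rcases p with p | p <;> rcases q with q | q <;> simp only [hDP, hDQ]
    · have := congr_fun (congr_fun hAeq p) q
      simpa [hA', Matrix.mul_apply, mul_comm] using this
    · have : B' = (Q * τ).transpose - P := by simp [P]
      have := congr_fun (congr_fun this p) q
      simpa [hB', Matrix.mul_apply, Matrix.one_apply, mul_comm] using this
    · have : B' = (Q * τ).transpose - P := by simp [P]
      have := congr_fun (congr_fun this q) p
      simp [hB', Matrix.mul_apply, Matrix.one_apply, mul_comm] at this ⊢
      rw [this]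
      ring
    · have : C' = Q.transpose - Q := by
        simp only [Q, Matrix.transpose_smul, hCt]
        module
      have := congr_fun (congr_fun this p) q
      simpa [hC', Matrix.one_apply] using this
  refine mem_neronSeveri_of_dual l D fun x y => ?_
  let E₂ : Λ →ₗ[ℤ] Λ →ₗ[ℤ] ℂ := LinearMap.mk₂ ℤ (fun v w => (E v w : ℂ)) (by simp) (by simp)
    (by simp) (by simp)
  let D₂ : Λ →ₗ[ℤ] Λ →ₗ[ℤ] ℂ := LinearMap.mk₂ ℤ (fun v w => D w v - D v w)
    (fun _ _ _ => by simp; ring) (fun _ _ _ => by simp; ring)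
    (fun _ _ _ => by simp; ring) (fun _ _ _ => by simp; ring)
  have : E₂ = D₂ := LinearMap.ext_basis l l hbasis
  exact congr_arg (fun F : Λ →ₗ[ℤ] Λ →ₗ[ℤ] ℂ => F x y) this

end RiemannRelation

section AlternatingMatrix

variable {g : ℕ}

/-- The data of an integral alternating form in two blocks. -/
abbrev AltBlocks (g : ℕ) : Type :=
  ((Σ k : Fin g, Fin k) → ℤ) × Matrix (Fin g) (Fin g) ℤ × ((Σ k : Fin g, Fin k) → ℤ)

/-- The alternating matrix with given entries above the diagonal. -/
def altMatrix (a : (Σ k : Fin g, Fin k) → ℤ) : Matrix (Fin g) (Fin g) ℤ :=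
  Matrix.of fun j k =>
    if h : j < k then a ⟨k, ⟨j, h⟩⟩ else if h : k < j then -a ⟨j, ⟨k, h⟩⟩ else 0

theorem altMatrix_transpose (a : (Σ k : Fin g, Fin k) → ℤ) :
    (altMatrix a).transpose = -altMatrix a := by
  ext j k
  simp only [altMatrix, Matrix.transpose_apply, Matrix.of_apply, Matrix.neg_apply]
  rcases lt_trichotomy j k with h | h | h
  · simp [h, h.not_gt]
  · simp [h]
  · simp [h, h.not_gt]

theorem altMatrix_add (a b : (Σ k : Fin g, Fin k) → ℤ) :
    altMatrix (a + b) = altMatrix a + altMatrix b := by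
  ext j k
  simp only [altMatrix, Matrix.of_apply, Matrix.add_apply, Pi.add_apply]
  split_ifs <;> ring

theorem altMatrix_apply (a : (Σ k : Fin g, Fin k) → ℤ) (s : Σ k : Fin g, Fin k) :
    altMatrix a (Fin.castLE s.1.2.le s.2) s.1 = a s := by
  have h : Fin.castLE s.1.2.le s.2 < s.1 := s.2.2
  simp only [altMatrix, Matrix.of_apply, h, dif_pos]
  rfl

theorem altMatrix_injective : Function.Injective (altMatrix (g := g)) := fun a b h => by
  ext s
  rw [← altMatrix_apply a, h, altMatrix_apply]

theorem eq_zero_of_transpose_eq_neg {K : Type*} [Field K] [CharZero K]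
    {M : Matrix (Fin g) (Fin g) K}
    (hM : M.transpose = -M)
    (h : ∀ s : Σ k : Fin g, Fin k, M (Fin.castLE s.1.2.le s.2) s.1 = 0) : M = 0 := by
  have hlt : ∀ j k : Fin g, j < k → M j k = 0 := fun j k hjk => h ⟨k, ⟨j, hjk⟩⟩
  ext j k
  have h1 : M k j = -M j k := congr_fun (congr_fun hM j) k
  rcases lt_trichotomy j k with hjk | rfl | hjk
  · exact hlt j k hjk
  · simpa using self_eq_neg.1 h1
  · rw [hlt k j hjk] at h1
    simpa using h1.symm

theorem two_mul_card_sigma_add (g : ℕ) : 2 * Fintype.card (Σ k : Fin g, Fin k) + g = g ^ 2 := by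
  rw [Fintype.card_sigma]
  simp only [Fintype.card_fin]
  rw [Fin.sum_univ_eq_sum_range (fun k => k), mul_comm, Finset.sum_range_id_mul_two]
  rcases g with _ | g
  · rfl
  · simp only [Nat.add_sub_cancel]
    ring

end AlternatingMatrix

theorem finrank_int_range_le {M N : Type*} [AddCommGroup M] [AddCommGroup N] [Module ℚ N]
    [FiniteDimensional ℚ N] (f : M →ₗ[ℤ] N) : finrank ℤ (LinearMap.range f) ≤ finrank ℚ N := by
  have h : Module.rank ℤ N = Module.rank ℚ N :=
    (IsLocalization.rank_eq ℚ (nonZeroDivisors ℤ) le_rfl).symm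
  have hlt : Module.rank ℤ N < Cardinal.aleph0 := h ▸ Module.rank_lt_aleph0 ℚ N
  calc finrank ℤ (LinearMap.range f) ≤ finrank ℤ N :=
        Module.finrank_le_finrank_of_rank_le_rank
          (Cardinal.lift_le.2 (Submodule.rank_le _)) hlt
    _ = finrank ℚ N := congr_arg Cardinal.toNat h

/-- Rank–nullity for the Riemann relation on integral blocks: by antisymmetry only entries above the
diagonal count, each worth at most `[K : ℚ]` conditions, and the kernel embeds in the Néron–Severi
group. -/
theorem le_picardNumber {g : ℕ} (b : Basis (Fin g) ℂ V) (l : Basis (Fin g ⊕ Fin g) ℤ Λ)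
    (τ : Matrix (Fin g) (Fin g) ℂ) (hl : ∀ p i, b.repr (l p) i = Matrix.fromCols τ 1 i p)
    (K : IntermediateField ℚ ℂ) [FiniteDimensional ℚ K] (hK : ∀ i j, τ i j ∈ K) :
    2 * Fintype.card (Σ k : Fin g, Fin k) + g ^ 2 ≤
      picardNumber Λ + finrank ℚ K * Fintype.card (Σ k : Fin g, Fin k) := by
  let τK : Matrix (Fin g) (Fin g) K := Matrix.of fun i j => ⟨τ i j, hK i j⟩
  let ιK := Int.castRingHom K
  let r : AltBlocks g → Matrix (Fin g) (Fin g) K := fun w => riemannRelation τK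
    ((altMatrix w.1).map ιK) (w.2.1.map ιK) ((altMatrix w.2.2).map ιK)
  have hr : ∀ w w', r (w + w') = r w + r w' := by
    intro w w'
    simp only [r, Prod.fst_add, Prod.snd_add, altMatrix_add, Matrix.map_add ιK (map_add ιK),
      riemannRelation, Matrix.transpose_add, Matrix.mul_add, Matrix.add_mul]
    abel
  have hmapt : ∀ {L : Type} [CommRing L] (a : (Σ k : Fin g, Fin k) → ℤ),
      ((altMatrix a).map (Int.castRingHom L)).transpose =
        -(altMatrix a).map (Int.castRingHom L) := by
    intro L _ a
    rw [← Matrix.transpose_map, altMatrix_transpose]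
    ext
    simp
  let f : AltBlocks g →ₗ[ℤ] ((Σ k : Fin g, Fin k) → K) :=
    (AddMonoidHom.mk' (fun w s => r w (Fin.castLE s.1.2.le s.2) s.1) fun w w' => by
      ext1 s
      simp only [hr]
      rfl).toIntLinearMap
  have hf : ∀ w ∈ LinearMap.ker f, r w = 0 := fun w hw =>
    eq_zero_of_transpose_eq_neg (riemannRelation_transpose _ (hmapt _) (hmapt _))
      fun s => congr_fun hw s
  let m : AltBlocks g → Matrix (Fin g ⊕ Fin g) (Fin g ⊕ Fin g) ℤ := fun w =>
    Matrix.fromBlocks (altMatrix w.1) w.2.1 (-w.2.1.transpose) (altMatrix w.2.2)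
  have hm : ∀ w ∈ LinearMap.ker f, (LinearMap.BilinForm.toMatrix l).symm (m w) ∈ neronSeveri Λ := by
    intro w hw
    refine mem_neronSeveri_of_riemannRelation b l τ hl
      ((LinearMap.BilinForm.toMatrix l).apply_symm_apply _) (altMatrix_transpose _) ?_
    have h := congr_arg (fun M : Matrix (Fin g) (Fin g) K => M.map (algebraMap K ℂ)) (hf w hw)
    simp only [r, riemannRelation_map] at h
    simpa [Matrix.map_map, Function.comp_def, ιK] using! h
  let e : LinearMap.ker f →ₗ[ℤ] neronSeveri Λ :=
    (AddMonoidHom.mk' (fun w => ⟨_, hm w.1 w.2⟩) fun w w' => by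
      refine Subtype.ext ?_
      change _ = (LinearMap.BilinForm.toMatrix l).symm (m w) +
        (LinearMap.BilinForm.toMatrix l).symm (m w')
      rw [← map_add]
      simp [m, altMatrix_add, Matrix.fromBlocks_add, add_comm]).toIntLinearMap
  have he : Function.Injective e := by
    rintro ⟨w, hw⟩ ⟨w', hw'⟩ h
    have h1 : m w = m w' :=
      (LinearMap.BilinForm.toMatrix l).symm.injective (congr_arg Subtype.val h)
    obtain ⟨hA, hB, -, hC⟩ := Matrix.fromBlocks_inj.1 h1
    exact Subtype.ext (Prod.ext (altMatrix_injective hA)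
      (Prod.ext hB (altMatrix_injective hC)))
  have : Module.Finite ℤ Λ := Module.Finite.of_basis l
  have : Module.Free ℤ Λ := Module.Free.of_basis l
  have : Module.Finite ℤ (neronSeveri Λ) :=
    Module.Finite.of_injective (neronSeveri Λ).subtype.toIntLinearMap Subtype.val_injective
  have h1 : finrank ℤ (LinearMap.ker f) ≤ picardNumber Λ :=
    LinearMap.finrank_le_finrank_of_injective he
  have h2 : finrank ℤ (LinearMap.range f) ≤
      finrank ℚ K * Fintype.card (Σ k : Fin g, Fin k) := by
    refine (finrank_int_range_le f).trans_eq ?_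
    rw [Module.finrank_pi_fintype, Finset.sum_const, Finset.card_univ, smul_eq_mul, mul_comm]
  have h3 := Submodule.finrank_quotient_add_finrank (LinearMap.ker f)
  rw [f.quotKerEquivRange.finrank_eq] at h3
  have h4 : finrank ℤ (AltBlocks g) = 2 * Fintype.card (Σ k : Fin g, Fin k) + g ^ 2 := by
    simp only [Module.finrank_prod, Module.finrank_fintype_fun_eq_card, Module.finrank_matrix,
      Fintype.card_fin, Module.finrank_self]
    ring
  omega

end LowerBound

/-! ### Period fields in the maximal case. -/

section MaximalPicardNumber

section PeriodDegree

variable {g : ℕ} {τ : Matrix (Fin g) (Fin g) ℂ}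

theorem exists_im_ne_zero (hg : 0 < g) (hτ : (τ.map Complex.im).det ≠ 0) :
    ∃ i j, (τ i j).im ≠ 0 := by
  by_contra! h
  refine hτ ?_
  have : τ.map Complex.im = 0 := by
    ext i j
    exact h i j
  have := Fin.pos_iff_nonempty.1 hg
  rw [‹τ.map Complex.im = 0›, Matrix.det_zero]

theorem periodDegree_ne_one {i j : Fin g} (h : (τ i j).im ≠ 0) : periodDegree τ ≠ 1 := by
  intro hd
  rw [periodDegree, IntermediateField.finrank_eq_one_iff] at hd
  have hmem : τ i j ∈ IntermediateField.adjoin ℚ {z : ℂ | ∃ i j, z = τ i j} :=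
    IntermediateField.subset_adjoin _ _ ⟨i, j, rfl⟩
  rw [hd, IntermediateField.mem_bot] at hmem
  obtain ⟨q, hq⟩ := hmem
  rw [← hq] at h
  simp at h

/-- The period field lies in `ℚ(z)`, of degree at most 2, and contains a nonreal number. -/
theorem periodDegree_eq_two {i j : Fin g} (h : (τ i j).im ≠ 0) {z : ℂ} {q : ℚ} (hz : z ^ 2 = q)
    (A B : Matrix (Fin g) (Fin g) ℚ) (hτ : ∀ i j, τ i j = A i j + B i j * z) :
    periodDegree τ = 2 := by
  let p : Polynomial ℚ := Polynomial.X ^ 2 - Polynomial.C q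
  have hp : p.Monic := Polynomial.monic_X_pow_sub_C q two_ne_zero
  have hpz : Polynomial.aeval z p = 0 := by simp [p, hz]
  have hint : IsIntegral ℚ z := ⟨p, hp, hpz⟩
  have := IntermediateField.adjoin.finiteDimensional hint
  have hle : IntermediateField.adjoin ℚ {z : ℂ | ∃ i j, z = τ i j} ≤
      IntermediateField.adjoin ℚ {z} := by
    rw [IntermediateField.adjoin_le_iff]
    rintro _ ⟨i, j, rfl⟩
    rw [hτ]
    have hQ : ∀ r : ℚ, (r : ℂ) ∈ IntermediateField.adjoin ℚ {z} := fun r =>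
      (IntermediateField.adjoin ℚ {z}).algebraMap_mem r
    exact add_mem (hQ _) (mul_mem (hQ _) (IntermediateField.mem_adjoin_simple_self ℚ z))
  have h2 : periodDegree τ ≤ 2 := by
    refine (IntermediateField.finrank_le_of_le_right hle).trans ?_
    rw [IntermediateField.adjoin.finrank hint]
    refine (Polynomial.natDegree_le_of_dvd (minpoly.dvd ℚ z hpz) hp.ne_zero).trans ?_
    simp [p]
  have hfin : FiniteDimensional ℚ (IntermediateField.adjoin ℚ {z : ℂ | ∃ i j, z = τ i j}) :=
    FiniteDimensional.of_injective (IntermediateField.inclusion hle).toLinearMap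
      (IntermediateField.inclusion_injective hle)
  have h0 : 0 < periodDegree τ := Module.finrank_pos
  have h1 := periodDegree_ne_one h
  omega

end PeriodDegree

variable {Λ : Submodule ℤ V}

/-- If the Picard number is maximal, the periods lie in an imaginary quadratic field. -/
theorem exists_imaginary_quadratic_of_picardNumber_eq {g : ℕ} (hg : 2 ≤ g)
    {τ : Matrix (Fin g) (Fin g) ℂ} (b : Basis (Fin g) ℂ V) (l : Basis (Fin g ⊕ Fin g) ℤ Λ)
    (lR : Basis (Fin g ⊕ Fin g) ℝ V) (hlR : ∀ p, lR p = l p)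
    (hl : ∀ p i, b.repr (l p) i = Matrix.fromCols τ 1 i p) (hρ : picardNumber Λ = g ^ 2) :
    ∃ (y : ℝ) (q : ℚ) (A B : Matrix (Fin g) (Fin g) ℚ), 0 < y ∧ y ^ 2 = q ∧
      ∀ i j, τ i j = A i j + B i j * (y * Complex.I) := by
  have := b.finiteDimensional_of_finite
  have : Nontrivial (Fin g) := Fin.nontrivial_iff_two_le.2 hg
  obtain ⟨y, q, R, hy, hyq, hR⟩ := exists_rational_smul l lR hlR b
    (by rw [hρ, Fintype.card_fin])
  suffices h : ∃ A B : Matrix (Fin g) (Fin g) ℚ, ∀ i j, τ i j = A i j + B i j * (y * Complex.I) by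
    obtain ⟨A, B, hAB⟩ := h
    rcases hy.lt_or_gt with hneg | hpos
    · refine ⟨-y, q, A, -B, neg_pos.2 hneg, by rw [neg_sq, hyq], fun i j => ?_⟩
      rw [hAB]
      simp
    · exact ⟨y, q, A, B, hpos, hyq, hAB⟩
  let c : ℚ →+* ℂ := algebraMap ℚ ℂ
  let P : Matrix (Fin g) (Fin g) ℚ := R.toBlocks₁₂
  let Q : Matrix (Fin g) (Fin g) ℚ := R.toBlocks₂₂
  let z : ℂ := y * Complex.I
  -- The right half of `z (τ I) = (τ I) R`.
  have hz : z • (1 : Matrix (Fin g) (Fin g) ℂ) = τ * P.map c + Q.map c := by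
    ext i j
    have h := congr_arg (fun v => b.repr v i) (hR (Sum.inr j))
    simp only [hlR, ← Complex.coe_smul, map_smul, Finsupp.smul_apply, hl, Fintype.sum_sum_type,
      Matrix.fromCols_apply_inr, smul_eq_mul] at h
    rw [Matrix.smul_apply, smul_eq_mul, h, Matrix.add_apply, Matrix.mul_apply]
    simp [hl, Matrix.one_apply, P, Q, c, mul_comm, Matrix.toBlocks₁₂, Matrix.toBlocks₂₂]
  -- Taking imaginary parts gives `Im τ · P = y · 1`, so `P` is invertible and `τ = (z - Q) P⁻¹`.
  have hdet : P.det ≠ 0 := by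
    intro h0
    have hi : τ.map Complex.im * P.map (Rat.cast : ℚ → ℝ) = y • 1 := by
      ext i j
      have h := congr_arg Complex.im (congr_fun (congr_fun hz i) j)
      have hcast : ∀ r : ℚ, c r = ((r : ℝ) : ℂ) := fun r => by simp [c]
      simp only [Matrix.smul_apply, smul_eq_mul, Matrix.add_apply, Matrix.mul_apply,
        Matrix.map_apply, Complex.add_im, Complex.im_sum, hcast, Complex.im_mul_ofReal,
        Complex.ofReal_im, add_zero] at h
      rw [Matrix.mul_apply]
      simp only [Matrix.map_apply]
      rw [← h]
      by_cases hij : i = j <;> simp [Matrix.one_apply, hij, z]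
    have h := congr_arg Matrix.det hi
    have hP : (P.map (Rat.cast : ℚ → ℝ)).det = 0 := by
      have := (RingHom.map_det (Rat.castHom ℝ) P).symm
      rw [h0, map_zero] at this
      exact this
    rw [Matrix.det_mul, hP, mul_zero, Matrix.det_smul, Matrix.det_one, mul_one] at h
    exact pow_ne_zero _ hy h.symm
  have hinv : P * P⁻¹ = 1 := Matrix.mul_nonsing_inv P (isUnit_iff_ne_zero.2 hdet)
  have hinv' : P.map c * P⁻¹.map c = 1 := by
    rw [← Matrix.map_mul, hinv, Matrix.map_one c (map_zero c) (map_one c)]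
  refine ⟨-(Q * P⁻¹), P⁻¹, fun i j => ?_⟩
  have hτ : τ = z • P⁻¹.map c - (Q * P⁻¹).map c := by
    have h : (z • (1 : Matrix (Fin g) (Fin g) ℂ) - Q.map c) * P⁻¹.map c = τ := by
      rw [hz, add_sub_cancel_right, Matrix.mul_assoc, hinv', Matrix.mul_one]
    rw [← h, Matrix.sub_mul, Matrix.smul_mul, Matrix.one_mul, Matrix.map_mul]
  have h := congr_fun (congr_fun hτ i) j
  simp only [Matrix.sub_apply, Matrix.smul_apply, Matrix.map_apply, smul_eq_mul] at h
  rw [h]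
  simp [c, z]
  ring

end MaximalPicardNumber

end ComplexTorus

/-! ### The main theorem. -/

open ComplexTorus in
theorem theorem1p2 {V : Type*} [NormedAddCommGroup V] [NormedSpace ℂ V]
    (Λ : Submodule ℤ V) [DiscreteTopology Λ] [IsZLattice ℝ Λ]
    (g : ℕ) (hg : 2 ≤ g) (τ : Matrix (Fin g) (Fin g) ℂ)
    (hτ : (τ.map Complex.im).det ≠ 0)
    (hΛ : ComplexTorus.IsPeriodMatrix Λ (Matrix.fromCols τ 1)) :
    ((ComplexTorus.periodDegree τ = 2 ↔ ComplexTorus.picardNumber Λ = g ^ 2) ∧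
      (ComplexTorus.picardNumber Λ = g ^ 2 → ComplexTorus.IsAbelianVariety Λ)) ∧
    (ComplexTorus.periodDegree τ = 3 →
      g * (g + 1) / 2 ≤ ComplexTorus.picardNumber Λ ∧ ComplexTorus.picardNumber Λ < g ^ 2) ∧
    (ComplexTorus.periodDegree τ = 4 →
      g ≤ ComplexTorus.picardNumber Λ ∧ ComplexTorus.picardNumber Λ < g ^ 2) := by
  obtain ⟨b, l, hbl⟩ := hΛ
  have hfin := b.finiteDimensional_of_finite
  have hfinR : FiniteDimensional ℝ V := FiniteDimensional.complexToReal V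
  have hproper : ProperSpace V := FiniteDimensional.proper ℝ V
  let lR : Module.Basis (Fin g ⊕ Fin g) ℝ V := l.ofZLatticeBasis ℝ Λ
  have hlR : ∀ p, lR p = l p := l.ofZLatticeBasis_apply ℝ Λ
  have hl : ∀ p i, b.repr (l p) i = Matrix.fromCols τ 1 i p := by
    intro p i
    rw [hbl, b.repr_sum_self]
  obtain ⟨i₀, j₀, him⟩ := exists_im_ne_zero (by omega) hτ
  have hle : picardNumber Λ ≤ g ^ 2 := by simpa using picardNumber_le l lR hlR b
  have hquad := exists_imaginary_quadratic_of_picardNumber_eq hg b l lR hlR hl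
  have hdeg : picardNumber Λ = g ^ 2 → periodDegree τ = 2 := by
    intro hρ
    obtain ⟨y, q, A, B, -, hyq, hAB⟩ := hquad hρ
    refine periodDegree_eq_two him (z := y * Complex.I) (q := -q) ?_ A B hAB
    rw [mul_pow, Complex.I_sq, ← Complex.ofReal_pow, hyq]
    simp
  -- Degree 0 is the default value for an infinite extension; excluding it makes the period field
  -- finite over `ℚ`.
  have hge : periodDegree τ ≠ 0 →
      2 * Fintype.card (Σ k : Fin g, Fin k) + g ^ 2 ≤
        picardNumber Λ + periodDegree τ * Fintype.card (Σ k : Fin g, Fin k) := by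
    intro hd
    have : FiniteDimensional ℚ (IntermediateField.adjoin ℚ {z : ℂ | ∃ i j, z = τ i j}) :=
      Module.finite_of_finrank_pos (Nat.pos_of_ne_zero hd)
    exact le_picardNumber b l τ hl _ fun i j => IntermediateField.subset_adjoin _ _ ⟨i, j, rfl⟩
  have hcard := two_mul_card_sigma_add g
  have hlt : periodDegree τ ≠ 2 → picardNumber Λ < g ^ 2 := fun h =>
    lt_of_le_of_ne hle fun hρ => h (hdeg hρ)
  refine ⟨⟨⟨fun hd => ?_, hdeg⟩, fun hρ => ?_⟩, fun hd => ⟨?_, hlt (by omega)⟩,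
    fun hd => ⟨?_, hlt (by omega)⟩⟩
  · have := hge (by omega)
    rw [hd] at this
    omega
  · obtain ⟨y, q, A, B, hy, -, hAB⟩ := hquad hρ
    refine isAbelianVariety_of_imaginary_quadratic b l hy
      (fun p i => Matrix.fromCols A 1 i p) (fun p i => Matrix.fromCols B 0 i p) ?_
    rintro (p | p) i
    · simp [hl, hAB]
    · simp [hl, Matrix.one_apply, apply_ite]
  · have := hge (by omega)
    rw [hd] at this
    have hexp : g * (g + 1) = g ^ 2 + g := by ring
    rw [hexp]
    omega
  · have := hge (by omega)
    rw [hd] at this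
    omega
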